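/- Let $\mathcal A$ be an effective Boolean algebra of predicates over a domain $\mathcal D$, and let $M$ be a symbolic tree automaton over $\mathcal A$, with finitely many states, at least one transition, and guards $\psi_1,\dots,\psi_m$. Let $\phi_1,\dots,\phi_k$ be predicates of $\mathcal A$, and let $L_1,\dots,L_m$ be pairwise distinct propositional formulas in the variables $S_1,\dots,S_k$ such that $\psi_j$ is equivalent to $L_j(\phi_1,\dots,\phi_k)$. Replace each guard $\psi_j$ of $M$ by $L_j$. Write $M(L_1,\dots,L_m)$ for the set of binary trees $\tau$ labelled by bit-strings in $\{0,1\}^k$ that the resulting automaton accepts, where a transition with guard $L_j$ may read $\beta$ if and only if $\beta\models L_j$ (the tree tables). Write $M_S(L_1,\dots,L_m)$ for the set of trees labelled by the letters $L_j$ that it generates (the symbolic tables). Let $\rho(k_1,\dots,k_m)$ say that some symbolic table in $M_S(L_1,\dots,L_m)$ has exactly $k_j$ occurrences of the letter $L_j$ for every $j\in[m]=\{1,\dots,m\}$. Let $F$ be a QFBAPA formula (quantifier-free Boolean algebra with Presburger arithmetic) in the set variables $S_1,\dots,S_k$, possibly with integer variables, which are read existentially. Let $|F|$ be the number of symbols of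 $F$. Sets are sets of tree positions in $\{0,1\}^*$, and complements and the universal set are taken relative to a finite universe $U\subseteq\{0,1\}^*$. For $\beta\in\{0,1\}^k$ put $p_\beta=\bigcap_{i=1}^k S_i^{\beta_i}$, with $S^1=S$ and $S^0=U\setminus S$, and $p_L=\bigcup_{\beta\models L}p_\beta$. Let $\phi^\beta(d)$ be the conjunction of the $\phi_i(d)$ with $\beta_i=1$ and the $\neg\phi_i(d)$ with $\beta_i=0$. There is a polynomial $p$, independent of $\mathcal A$, $M$, $k$, $m$, the $\phi_i$, the $L_j$ and $F$, such that the following two statements are always equivalent. (1) (Non-emptiness with cardinalities.) There are a finite set $U$ of positions and sets $S_1,\dots,S_k\subseteq U$ such that $F(S_1,\dots,S_k)$ holds in the universe $U$; there is a finite binary tree $d$ over $\mathcal D$ with domain $U$ and $S_i=\{n\in U\mid\phi_i(d(n))\}$ for all $i$; and there is $\tau\in M(L_1,\dots,L_m)$ with domain $U$ and $S_i=\{n\in U\mid\tau_i(n)=1\}$ for all $i$. (2) There are $s\in[m]$, a number $N\le s+p(|F|)$, an injection $\sigma:[s]\hookrightarrow[m]$ and $\beta_1,\dots,\beta_N\in\{0,1\}^k$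 such that $\exists d\in\mathcal D.\ \phi^{\beta_j}(d)$ for every $j\in[N]$, and there are $k_1,\dots,k_m\in\mathbb N$, a finite set $U\subseteq\{0,1\}^*$ and sets $S_1,\dots,S_k,P_1,\dots,P_s\subseteq U$ such that $$\rho(k_1,\dots,k_m)\ \wedge\ \bigwedge_{j\notin\sigma([s])}k_j=0\ \wedge\ \bigwedge_{i=1}^s P_i\subseteq p_{L_{\sigma(i)}}\ \wedge\ \bigwedge_{i=1}^s|P_i|=k_{\sigma(i)}\ \wedge\ F(S_1,\dots,S_k),$$ the sets $P_1,\dots,P_s$ are pairwise disjoint, and $$U=\bigcup_{i=1}^sP_i=\bigcup_{j=1}^m p_{L_j}=\bigcup_{j=1}^N p_{\beta_j}.$$ -/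

import Mathlib

namespace SymbolicTree

/-! ### Predicate algebras, propositional formulas and symbolic tree automata -/

/-- An effective Boolean algebra of unary predicates: `D` is the domain, `Ψ` the set of predicates,
`den ψ` the set of elements satisfying `ψ`. (Decidability of `den ψ ≠ ∅` is not required, so that
everything below holds for more structures than the effective Boolean algebras.) -/
structure BooleanAlg (D Ψ : Type*) where
  den : Ψ → Set D
  bot : Ψ
  top : Ψ
  or : Ψ → Ψ → Ψ
  and : Ψ → Ψ → Ψ
  neg : Ψ → Ψ
  den_bot : den bot = ∅
  den_top : den top = Set.univ
  den_or : ∀ a b, den (or a b) = den a ∪ den b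
  den_and : ∀ a b, den (and a b) = den a ∩ den b
  den_neg : ∀ a, den (neg a) = (den a)ᶜ

/-- Propositional formulas in the variables `S_0, …, S_{k-1}`. -/
inductive PropForm (k : ℕ) : Type
  | var : Fin k → PropForm k
  | bot : PropForm k
  | top : PropForm k
  | or : PropForm k → PropForm k → PropForm k
  | and : PropForm k → PropForm k → PropForm k
  | neg : PropForm k → PropForm k

/-- `L.Models β` is `β ⊨ L`, for a bit-string `β ∈ {0,1}^k`. -/
def PropForm.Models {k : ℕ} : PropForm k → (Fin k → Bool) → Prop
  | .var i, β => β i = true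
  | .bot, _ => False
  | .top, _ => True
  | .or a b, β => a.Models β ∨ b.Models β
  | .and a b, β => a.Models β ∧ b.Models β
  | .neg a, β => ¬ a.Models β

/-- The predicate obtained from a propositional formula by putting the predicate `φ i` for the
`i`-th variable. -/
def BooleanAlg.interp {D Ψ : Type*} (A : BooleanAlg D Ψ) {k : ℕ} (φ : Fin k → Ψ) :
    PropForm k → Ψ
  | .var i => φ i
  | .bot => A.bot
  | .top => A.top
  | .or a b => A.or (A.interp φ a) (A.interp φ b)
  | .and a b => A.and (A.interp φ a) (A.interp φ b)
  | .neg a => A.neg (A.interp φ a)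

/-- The formula `φ^β(d)`: the conjunction of the `φ_i(d)` with `β_i = 1` and of the `¬ φ_i(d)` with
`β_i = 0`. -/
def BooleanAlg.CharFormula {D Ψ : Type*} (A : BooleanAlg D Ψ) {k : ℕ} (φ : Fin k → Ψ)
    (β : Fin k → Bool) (d : D) : Prop :=
  ∀ i, if β i = true then d ∈ A.den (φ i) else d ∈ A.den (A.neg (φ i))

/-- The label of a binary tree at a position in `{0,1}^*` (`false` is the left son and `true` the
right son), `none` outside of the domain of the tree. -/
def labelAt {α : Type*} : BinaryTree α → List Bool → Option α
  | .nil, _ => none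
  | .node a _ _, [] => some a
  | .node _ l _, false :: n => labelAt l n
  | .node _ _ r, true :: n => labelAt r n

/-- The domain of a binary tree: a finite set of positions that is closed under prefixes. -/
def positions {α : Type*} (t : BinaryTree α) : Set (List Bool) :=
  {n | (labelAt t n).isSome}

/-- A symbolic tree automaton with states `Q` and guards in `Ψ`. A transition `(q₁, ψ, q₂, q₃)` has
source states `q₁`, `q₂` and target state `q₃`. -/
structure STA (Q Ψ : Type*) where
  init : Q
  final : Set Q
  trans : Set (Q × Ψ × Q × Q)
  finite_trans : trans.Finite

/-- The guards that occur in the transitions. -/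
def STA.guards {Q Ψ : Type*} (M : STA Q Ψ) : Set Ψ :=
  {ψ | ∃ q₁ q₂ q₃, (q₁, ψ, q₂, q₃) ∈ M.trans}

/-- `M.Accepts sat q t`: the tree `t` belongs to the language of `M` at the state `q`, where
`sat ψ a` says that the guard `ψ` admits the letter `a`. -/
inductive STA.Accepts {Q Ψ α : Type*} (M : STA Q Ψ) (sat : Ψ → α → Prop) :
    Q → BinaryTree α → Prop
  | nil {q : Q} : q ∈ M.final → M.Accepts sat q .nil
  | node {q₁ q₂ q₃ : Q} {ψ : Ψ} {a : α} {l r : BinaryTree α} :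
      (q₁, ψ, q₂, q₃) ∈ M.trans → sat ψ a → M.Accepts sat q₁ l → M.Accepts sat q₂ r →
      M.Accepts sat q₃ (.node a l r)

/-- The language of `M` (at the initial state). For `sat ψ d := d ∈ A.den ψ` this is the language
of a symbolic tree automaton over the algebra `A`. -/
def STA.language {Q Ψ α : Type*} (M : STA Q Ψ) (sat : Ψ → α → Prop) : Set (BinaryTree α) :=
  {t | M.Accepts sat M.init t}

/-- The automaton in which the guards `ψ_j` are replaced by the letters `L_j`. -/
def STA.relabel {Q Ψ X : Type*} (M : STA Q Ψ) {m : ℕ} (ψ : Fin m → Ψ) (L : Fin m → X) :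
    STA Q X where
  init := M.init
  final := M.final
  trans := {t | ∃ j, t.2.1 = L j ∧ (t.1, ψ j, t.2.2.1, t.2.2.2) ∈ M.trans}
  finite_trans := by
    refine Set.Finite.subset (Set.finite_iUnion (ι := Fin m) fun j =>
      M.finite_trans.image fun t : Q × Ψ × Q × Q => (t.1, L j, t.2.2.1, t.2.2.2)) ?_
    rintro ⟨q₁, x, q₂, q₃⟩ ⟨j, rfl, h⟩
    exact Set.mem_iUnion.2 ⟨j, _, h, rfl⟩

/-- The set `M(L_1, …, L_m)` of tree tables: the trees of bit-strings accepted by the automaton `M`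
with propositional guards. -/
def tables {Q : Type*} {k : ℕ} (M : STA Q (PropForm k)) : Set (BinaryTree (Fin k → Bool)) :=
  M.language fun L β => L.Models β

/-- The set `M_S(L_1, …, L_m)` of symbolic tables: the trees of propositional formulas generated by
the automaton `M` with propositional guards. -/
def symbolicTables {Q : Type*} {k : ℕ} (M : STA Q (PropForm k)) :
    Set (BinaryTree (PropForm k)) :=
  M.language fun L L' => L = L'

/-- The number `|s|_x` of occurrences of the letter `x` in the tree `s`. -/
noncomputable def occurrences {α : Type*} (s : BinaryTree α) (x : α) : ℕ :=
  {n | labelAt s n = some x}.ncard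

/-- The Parikh image of `M_S(L_1, …, L_m)`. -/
def parikh {Q : Type*} {k m : ℕ} (M : STA Q (PropForm k)) (L : Fin m → PropForm k) :
    Set (Fin m → ℕ) :=
  {c | ∃ s ∈ symbolicTables M, ∀ j, c j = occurrences s (L j)}

/-! ### Quantifier-free Boolean algebra with Presburger arithmetic -/

/-- Boolean terms over `k` set variables. -/
inductive BTerm (k : ℕ) : Type
  | var : Fin k → BTerm k
  | empty : BTerm k
  | univ : BTerm k
  | union : BTerm k → BTerm k → BTerm k
  | inter : BTerm k → BTerm k → BTerm k
  | compl : BTerm k → BTerm k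

/-- Presburger terms; the integer variables are indexed by `ℕ`. -/
inductive ITerm (k : ℕ) : Type
  | var : ℕ → ITerm k
  | const : ℤ → ITerm k
  | add : ITerm k → ITerm k → ITerm k
  | smul : ℤ → ITerm k → ITerm k
  | card : BTerm k → ITerm k

/-- Formulas of QFBAPA. -/
inductive QFBAPA (k : ℕ) : Type
  | setEq : BTerm k → BTerm k → QFBAPA k
  | setSub : BTerm k → BTerm k → QFBAPA k
  | eq : ITerm k → ITerm k → QFBAPA k
  | le : ITerm k → ITerm k → QFBAPA k
  | dvd : ℤ → ITerm k → QFBAPA k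
  | and : QFBAPA k → QFBAPA k → QFBAPA k
  | or : QFBAPA k → QFBAPA k → QFBAPA k
  | not : QFBAPA k → QFBAPA k

/-- The number of symbols of a Boolean term. -/
def BTerm.size {k : ℕ} : BTerm k → ℕ
  | .var _ => 1
  | .empty => 1
  | .univ => 1
  | .union a b => a.size + b.size + 1
  | .inter a b => a.size + b.size + 1
  | .compl a => a.size + 1

/-- The number of symbols of a Presburger term (an integer constant is one symbol). -/
def ITerm.size {k : ℕ} : ITerm k → ℕ
  | .var _ => 1
  | .const _ => 1
  | .add a b => a.size + b.size + 1
  | .smul _ a => a.size + 2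
  | .card b => b.size + 1

/-- The number `|F|` of symbols of a formula. -/
def QFBAPA.size {k : ℕ} : QFBAPA k → ℕ
  | .setEq a b => a.size + b.size + 1
  | .setSub a b => a.size + b.size + 1
  | .eq a b => a.size + b.size + 1
  | .le a b => a.size + b.size + 1
  | .dvd _ a => a.size + 2
  | .and a b => a.size + b.size + 1
  | .or a b => a.size + b.size + 1
  | .not a => a.size + 1

/-- Value of a Boolean term, in the finite universe `U`. -/
def BTerm.eval {ι : Type*} [DecidableEq ι] {k : ℕ} (U : Finset ι) (S : Fin k → Finset ι) :
    BTerm k → Finset ι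
  | .var i => S i
  | .empty => ∅
  | .univ => U
  | .union a b => a.eval U S ∪ b.eval U S
  | .inter a b => a.eval U S ∩ b.eval U S
  | .compl a => U \ a.eval U S

/-- Value of a Presburger term, where `v` gives the values of the integer variables. -/
def ITerm.eval {ι : Type*} [DecidableEq ι] {k : ℕ} (U : Finset ι) (S : Fin k → Finset ι)
    (v : ℕ → ℤ) : ITerm k → ℤ
  | .var i => v i
  | .const c => c
  | .add a b => a.eval U S v + b.eval U S v
  | .smul c a => c * a.eval U S v
  | .card b => ((b.eval U S).card : ℤ)

/-- Truth of a formula for given values of the set variables and of the integer variables. -/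
def QFBAPA.Sat {ι : Type*} [DecidableEq ι] {k : ℕ} (U : Finset ι) (S : Fin k → Finset ι)
    (v : ℕ → ℤ) : QFBAPA k → Prop
  | .setEq a b => a.eval U S = b.eval U S
  | .setSub a b => a.eval U S ⊆ b.eval U S
  | .eq a b => a.eval U S v = b.eval U S v
  | .le a b => a.eval U S v ≤ b.eval U S v
  | .dvd c a => c ∣ a.eval U S v
  | .and a b => a.Sat U S v ∧ b.Sat U S v
  | .or a b => a.Sat U S v ∨ b.Sat U S v
  | .not a => ¬ a.Sat U S v

/-- `F(S_1, …, S_k)` in the universe `U`; integer variables of `F` are read existentially. -/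
def QFBAPA.Holds {ι : Type*} [DecidableEq ι] {k : ℕ} (F : QFBAPA k) (U : Finset ι)
    (S : Fin k → Finset ι) : Prop :=
  ∃ v : ℕ → ℤ, F.Sat U S v

/-! ### Venn regions and the two formulas -/

/-- The elementary Venn region `p_β = ⋂_i S_i^{β_i}` in the universe `U`, where `S^1 = S` and
`S^0 = U \ S`. -/
def venn {ι : Type*} [DecidableEq ι] {k : ℕ} (U : Finset ι) (S : Fin k → Finset ι)
    (β : Fin k → Bool) : Finset ι :=
  U.filter fun n => ∀ i, n ∈ (if β i = true then S i else U \ S i)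

open Classical in
/-- The region `p_L = ⋃_{β ⊨ L} p_β` of a propositional formula `L`. -/
noncomputable def region {ι : Type*} [DecidableEq ι] {k : ℕ} (U : Finset ι)
    (S : Fin k → Finset ι) (L : PropForm k) : Finset ι :=
  U.filter fun n => ∃ β : Fin k → Bool, L.Models β ∧ n ∈ venn U S β

/-- Non-emptiness of the language of the symbolic tree automaton with the cardinality constraint
`F`: there are sets `S_1, …, S_k` of positions with `F(S_1, …, S_k)`, a tree `d` of characters with
`S_i = {n | φ_i(d(n))}` and a tree table `τ ∈ M(L_1, …, L_m)` with `S_i = {n | τ_i(n)}`. The universe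
`U` of positions is the common domain of `d` and `τ`. -/
def TablePowerCard {D Ψ Q : Type*} {k : ℕ} (A : BooleanAlg D Ψ) (φ : Fin k → Ψ)
    (M : STA Q (PropForm k)) (F : QFBAPA k) : Prop :=
  ∃ (U : Finset (List Bool)) (S : Fin k → Finset (List Bool)),
    F.Holds U S ∧
    (∃ d : BinaryTree D, positions d = U ∧
      ∀ i n, n ∈ S i ↔ ∃ a, labelAt d n = some a ∧ a ∈ A.den (φ i)) ∧
    (∃ τ ∈ tables M, positions τ = U ∧
      ∀ i n, n ∈ S i ↔ ∃ β, labelAt τ n = some β ∧ β i = true)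

/-- The formula that guesses `N ≤ s + b` elementary Venn regions `β_1, …, β_N`, each with a
satisfiable character formula, and finite sets of positions. The sets `P_1, …, P_s` are pairwise
disjoint and their union is the universe `U`, relative to which complements are taken. -/
def ElimPropCard {D Ψ Q : Type*} {k m : ℕ} (A : BooleanAlg D Ψ) (φ : Fin k → Ψ)
    (M : STA Q (PropForm k)) (L : Fin m → PropForm k) (F : QFBAPA k) (b : ℕ) : Prop :=
  ∃ (s : ℕ) (_ : 1 ≤ s ∧ s ≤ m) (N : ℕ) (_ : N ≤ s + b) (σ : Fin s ↪ Fin m)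
    (β : Fin N → Fin k → Bool),
    (∀ j, ∃ d, A.CharFormula φ (β j) d) ∧
    ∃ (c : Fin m → ℕ) (U : Finset (List Bool)) (S : Fin k → Finset (List Bool))
      (P : Fin s → Finset (List Bool)),
      (∀ i, S i ⊆ U) ∧
      c ∈ parikh M L ∧
      (∀ j, j ∉ Set.range σ → c j = 0) ∧
      (∀ i, P i ⊆ region U S (L (σ i))) ∧
      (∀ i i', i ≠ i' → Disjoint (P i) (P i')) ∧
      U = Finset.univ.biUnion P ∧
      (Finset.univ.biUnion fun j => region U S (L j)) = Finset.univ.biUnion P ∧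
      (∀ i, (P i).card = c (σ i)) ∧
      (Finset.univ.biUnion fun j => venn U S (β j)) = Finset.univ.biUnion P ∧
      F.Holds U S

end SymbolicTree

/-! A tree table is an instance of a symbolic table with the same domain
(`STA.accepts_iff_exists_symbolic`). The formula `F` depends only on the cardinalities of at most
`|F|` Boolean terms (`QFBAPA.Holds.congr`), so that the positions may be renamed by any bijection
that preserves their bit-strings; together with the counts of the letters this gives a table from a
solution of the formula (`ElimPropCard.tablePowerCard`).

Conversely, a table gives a solution in which all `2 ^ k` Venn regions may be nonempty, and the
point is to make do with `s + p(|F|)` of them, where `s` is the number of letters that occur. Give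
each position the label `(j, β)`, where `L j` is its letter and `β` its bit-string. It suffices to
change the bit-strings within the letters while keeping the `e ≤ |F|` cardinalities, which are sums
of `0`-`1`-vectors `v β` over the positions (`exists_sparse_relabelling`). To do this, form disjoint
pairs of labels in use with the same letter. All but at most one of the labels of each letter are
paired; hence if there are more than `s + 2 * (e + 7) ^ 2` labels, there are `q ≥ (e + 7) ^ 2`
pairs. The `2 ^ q` ways to choose one label from each pair give fewer than `2 ^ q` sums of vectors,
so two choices have the same sum. Replacing the labels of one choice by those of the other, at
equally many positions for each pair on which the choices differ, keeps the sums, and if that number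
of positions is as large as possible, a label gets out of use. As the labels are exchanged within
the pairs, the number of letters enters the bound with coefficient one only. -/

namespace SymbolicTree

open Finset

/-! ### Sparse relabelling -/

/-- Pair up elements of `B` that have the same colour, as many as possible: `g` exchanges the
elements of a pair and fixes the rest, and `A` contains one element of each pair. At most one
element of each colour stays unpaired. -/
theorem exists_pairing {Y I : Type*} [DecidableEq Y] [DecidableEq I] (f : Y → I) (B : Finset Y) :
    ∃ (A : Finset Y) (g : Y → Y), A ⊆ B ∧ Function.Involutive g ∧ (∀ y, f (g y) = f y) ∧
      (∀ y, y ∉ B → g y = y) ∧ (∀ y ∈ A, g y ∈ B ∧ g y ∉ A) ∧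
      #B ≤ #(B.image f) + 2 * #A := by
  induction B using Finset.strongInduction with
  | H B ih =>
    by_cases hinj : Set.InjOn f B
    · exact ⟨∅, id, by simp, fun _ => rfl, fun _ => rfl, fun _ _ => rfl, by simp,
        by simp [card_image_of_injOn hinj]⟩
    simp only [Set.InjOn, mem_coe, not_forall] at hinj
    obtain ⟨a, ha, b, hb, hf, hab⟩ := hinj
    obtain ⟨A, g, hA, hg, hfg, hfix, hgA, hcard⟩ := ih ((B.erase a).erase b)
      (((erase_subset _ _).trans_ssubset (erase_ssubset ha)))
    have ga : g a = a := hfix a (by simp)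
    have gb : g b = b := hfix b (by simp)
    have haA : a ∉ A := fun h => by simpa using hA h
    have hbA : b ∉ A := fun h => by simpa using hA h
    refine ⟨insert a A, fun y => if y = a then b else if y = b then a else g y,
      ?_, ?_, ?_, ?_, ?_, ?_⟩
    · exact insert_subset ha (hA.trans ((erase_subset _ _).trans (erase_subset _ _)))
    · intro y
      have := hg y
      grind
    · intro y
      have := hfg y
      grind
    · intro y hy
      have := hfix y (by simp [hy])
      grind
    · intro y hy
      rcases mem_insert.1 hy with rfl | hy
      · simp [hb, Ne.symm hab, hbA]
      · have h := hgA y hy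
        simp only [mem_erase] at h
        grind
    · have h1 : #((B.erase a).erase b) + 2 = #B := by
        rw [card_erase_of_mem (by simp [hb, Ne.symm hab]), card_erase_of_mem ha]
        have : 1 < #B := one_lt_card.2 ⟨a, ha, b, hb, hab⟩
        omega
      have h2 : #(((B.erase a).erase b).image f) ≤ #(B.image f) :=
        card_le_card (image_subset_image ((erase_subset _ _).trans (erase_subset _ _)))
      rw [card_insert_of_notMem haA]
      omega

/-- The numerical form of the pigeonhole argument: `2 ^ p` choices against `(2 * p + 1) ^ e` values.
-/
theorem two_mul_add_one_pow_lt_two_pow {e p : ℕ} (h : (e + 7) ^ 2 ≤ p) :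
    (2 * p + 1) ^ e < 2 ^ p := by
  set q := p / (e + 1) with hq
  have h1 : (e + 1) * q ≤ p := Nat.mul_div_le p (e + 1)
  have h2 : p < (e + 1) * (q + 1) := Nat.lt_mul_div_succ p (Nat.succ_pos e)
  have h3 : e + 7 ≤ q := by
    rw [hq, Nat.le_div_iff_mul_le (Nat.succ_pos e)]
    nlinarith
  have h4 : ∀ r : ℕ, 7 ≤ r → 2 * r * (r + 1) + 1 ≤ 2 ^ r := by
    intro r hr
    induction r, hr using Nat.le_induction with
    | base => norm_num
    | succ r hr ih => rw [pow_succ]; nlinarith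
  -- Since `e + 1 ≤ q`, one has `p < (e + 1) * (q + 1) ≤ q * (q + 1)`.
  have h5 : 2 * p + 1 ≤ 2 ^ q := by
    refine le_trans ?_ (h4 q (by omega))
    have : (e + 1) * (q + 1) ≤ q * (q + 1) := Nat.mul_le_mul_right _ (by omega)
    nlinarith
  calc (2 * p + 1) ^ e ≤ (2 ^ q) ^ e := Nat.pow_le_pow_left h5 e
    _ = 2 ^ (q * e) := (pow_mul _ _ _).symm
    _ < 2 ^ p := Nat.pow_lt_pow_right (by norm_num) (by nlinarith)

/-- Two different subsets of a large set have the same sum, by the pigeonhole principle: each of the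
`e` coordinates of a sum lies in `[-#A, #A]`. -/
theorem exists_ne_subsets_sum_eq {Y : Type*} [DecidableEq Y] {e : ℕ} (A : Finset Y)
    (hA : (e + 7) ^ 2 ≤ #A) (δ : Y → Fin e → ℤ) (hδ : ∀ y t, |δ y t| ≤ 1) :
    ∃ T ⊆ A, ∃ T' ⊆ A, T ≠ T' ∧ ∀ t, ∑ y ∈ T, δ y t = ∑ y ∈ T', δ y t := by
  have hlt : #(Fintype.piFinset fun _ : Fin e => Icc (-(#A : ℤ)) #A) < #A.powerset := by
    rw [Fintype.card_piFinset, card_powerset]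
    have : (#(Icc (-(#A : ℤ)) #A)) = 2 * #A + 1 := by
      rw [Int.card_Icc]; omega
    simpa [this] using two_mul_add_one_pow_lt_two_pow hA
  obtain ⟨T, hT, T', hT', hne, h⟩ := exists_ne_map_eq_of_card_lt_of_maps_to hlt
    (f := fun T t => ∑ y ∈ T, δ y t) (by
      intro T hT
      simp only [mem_coe, Fintype.mem_piFinset, mem_Icc]
      intro t
      rw [← abs_le]
      calc |∑ y ∈ T, δ y t| ≤ ∑ y ∈ T, |δ y t| := abs_sum_le_sum_abs _ _
        _ ≤ ∑ y ∈ T, 1 := sum_le_sum fun y _ => hδ y t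
        _ ≤ #A := by
          simpa using card_le_card (mem_powerset.1 hT))
  exact ⟨T, mem_powerset.1 hT, T', mem_powerset.1 hT', hne, fun t => congrFun h t⟩

/-- If `B` has many more elements than colours, then a nonempty set `D ⊆ B` can be replaced by a set
of elements of `B` outside of `D`, element by element and within the colours, without changing the
sum of the vectors `v`. -/
theorem exists_balanced_exchange {Y I : Type*} [DecidableEq Y] [DecidableEq I] {e : ℕ}
    (f : Y → I) (v : Y → Fin e → ℤ) (hv : ∀ y t, 0 ≤ v y t ∧ v y t ≤ 1) (B : Finset Y)
    (hB : #(B.image f) + 2 * (e + 7) ^ 2 < #B) :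
    ∃ (D : Finset Y) (g : Y → Y), D.Nonempty ∧ D ⊆ B ∧ (∀ y ∈ D, g y ∈ B ∧ g y ∉ D) ∧
      (∀ y, f (g y) = f y) ∧ ∀ t, ∑ y ∈ D, v (g y) t = ∑ y ∈ D, v y t := by
  obtain ⟨A, g, hAB, hg, hfg, -, hgA, hcard⟩ := exists_pairing f B
  obtain ⟨T, hT, T', hT', hne, hsum⟩ := exists_ne_subsets_sum_eq A (by omega : (e + 7) ^ 2 ≤ #A)
    -- A set `T ⊆ A` stands for the choice of `y` from the pair `{y, g y}` if `y ∈ T` and of `g y`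
    -- if `y ∈ A \ T`. Up to a constant, the sum of `v` over this choice is the sum of
    -- `v y - v (g y)` over `T`.
    (fun y t => v y t - v (g y) t) (fun y t => by
      have := hv y t; have := hv (g y) t; rw [abs_le]; omega)
  -- `D` consists of the elements that the choice `T` makes and the choice `T'` does not.
  have hdisj : Disjoint (T \ T') ((T' \ T).image g) := by
    rw [disjoint_left]
    intro y hy hy'
    obtain ⟨z, hz, rfl⟩ := mem_image.1 hy'
    exact (hgA z (hT' (mem_sdiff.1 hz).1)).2 (hT (mem_sdiff.1 hy).1)
  refine ⟨T \ T' ∪ (T' \ T).image g, g, ?_, ?_, ?_, hfg, ?_⟩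
  · rw [nonempty_iff_ne_empty]
    intro h
    rw [union_eq_empty, image_eq_empty, sdiff_eq_empty_iff_subset, sdiff_eq_empty_iff_subset] at h
    exact hne (h.1.antisymm h.2)
  · refine union_subset (sdiff_subset.trans (hT.trans hAB)) ?_
    intro y hy
    obtain ⟨z, hz, rfl⟩ := mem_image.1 hy
    exact (hgA z (hT' (mem_sdiff.1 hz).1)).1
  · intro y hy
    rcases mem_union.1 hy with hy | hy
    · have hyT := mem_sdiff.1 hy
      have h := hgA y (hT hyT.1)
      refine ⟨h.1, fun h' => ?_⟩
      rcases mem_union.1 h' with h' | h'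
      · exact h.2 (hT (mem_sdiff.1 h').1)
      · obtain ⟨z, hz, hzy⟩ := mem_image.1 h'
        rw [hg.injective hzy] at hz
        exact hyT.2 (mem_sdiff.1 hz).1
    · obtain ⟨z, hz, rfl⟩ := mem_image.1 hy
      have hzT := mem_sdiff.1 hz
      rw [hg z]
      refine ⟨hAB (hT' hzT.1), fun h' => ?_⟩
      rcases mem_union.1 h' with h' | h'
      · exact hzT.2 (mem_sdiff.1 h').1
      · obtain ⟨w, hw, hwz⟩ := mem_image.1 h'
        exact (hgA w (hT' (mem_sdiff.1 hw).1)).2 (hwz ▸ hT' hzT.1)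
  · intro t
    rw [sum_union hdisj, sum_union hdisj, sum_image hg.injective.injOn,
      sum_image hg.injective.injOn]
    simp only [hg _]
    have h1 := hsum t
    have h2 := sum_sdiff_sub_sum_sdiff (s₁ := T) (s₂ := T') (f := fun y => v y t - v (g y) t)
    simp only [sum_sub_distrib] at h1 h2
    linarith

/-- If the labelling `l` of `U` uses many more labels than colours, one label can be dispensed with:
the exchange of labels is carried out at equally many elements of `U` for each label in `D`, that
is, at all elements with the rarest one. -/
theorem exists_smaller_relabelling {ι Y I : Type*} [DecidableEq ι] [DecidableEq Y] [DecidableEq I]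
    {e : ℕ} (f : Y → I) (v : Y → Fin e → ℤ) (hv : ∀ y t, 0 ≤ v y t ∧ v y t ≤ 1)
    (U : Finset ι) (l : ι → Y)
    (hB : #((U.image l).image f) + 2 * (e + 7) ^ 2 < #(U.image l)) :
    ∃ l' : ι → Y, U.image l' ⊂ U.image l ∧ (∀ n, f (l' n) = f (l n)) ∧
      ∀ t, ∑ n ∈ U, v (l' n) t = ∑ n ∈ U, v (l n) t := by
  obtain ⟨D, g, hD, hDB, hgD, hfg, hsum⟩ := exists_balanced_exchange f v hv _ hB
  obtain ⟨y₀, hy₀, hmin⟩ := exists_min_image D (fun y => #{n ∈ U | l n = y}) hD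
  have hW : ∀ y ∈ D, ∃ W ⊆ {n ∈ U | l n = y}, #W = #{n ∈ U | l n = y₀} :=
    fun y hy => exists_subset_card_eq (hmin y hy)
  choose! W hWsub hWcard using hW
  have hW₀ : W y₀ = {n ∈ U | l n = y₀} := eq_of_subset_of_card_le (hWsub y₀ hy₀) (hWcard y₀ hy₀).ge
  refine ⟨fun n => if l n ∈ D ∧ n ∈ W (l n) then g (l n) else l n, ?_, ?_, ?_⟩
  · refine Finset.ssubset_iff_subset_ne.2 ⟨?_, fun h => ?_⟩
    · intro y hy
      obtain ⟨n, hn, rfl⟩ := mem_image.1 hy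
      split_ifs with h
      · exact (hgD _ h.1).1
      · exact mem_image_of_mem l hn
    · have := hDB hy₀
      rw [← h] at this
      obtain ⟨n, hn, hny⟩ := mem_image.1 this
      split_ifs at hny with h
      · exact (hgD _ h.1).2 (hny ▸ hy₀)
      · subst hny
        exact h ⟨hy₀, by simp [hW₀, hn]⟩
  · intro n
    dsimp only
    split_ifs
    · exact hfg _
    · rfl
  · intro t
    rw [← sub_eq_zero, ← sum_sub_distrib]
    have h1 : ∀ n ∈ U, v (if l n ∈ D ∧ n ∈ W (l n) then g (l n) else l n) t - v (l n) t =
        ∑ y ∈ D, if n ∈ W y then v (g y) t - v y t else 0 := by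
      intro n hn
      by_cases h : l n ∈ D
      · rw [sum_eq_single_of_mem (l n) h]
        · by_cases h' : n ∈ W (l n) <;> simp [h, h']
        · intro y hy hne
          rw [if_neg]
          intro hny
          exact hne (mem_filter.1 (hWsub y hy hny)).2.symm
      · rw [if_neg (fun h' => h h'.1), sub_self, sum_eq_zero]
        intro y hy
        rw [if_neg]
        intro hny
        exact h ((mem_filter.1 (hWsub y hy hny)).2 ▸ hy)
    rw [sum_congr rfl h1, sum_comm]
    have h2 : ∀ y ∈ D, (∑ n ∈ U, if n ∈ W y then v (g y) t - v y t else 0) =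
        (#{n ∈ U | l n = y₀} : ℤ) * (v (g y) t - v y t) := by
      intro y hy
      rw [← sum_filter, sum_const, nsmul_eq_mul, ← hWcard y hy]
      congr 3
      ext n
      simp only [mem_filter, and_iff_right_iff_imp]
      exact fun h => (mem_filter.1 (hWsub y hy h)).1
    rw [sum_congr rfl h2, ← mul_sum, sum_sub_distrib, hsum t, sub_self, mul_zero]

/-- A labelling of `U` can be replaced by one with the same colours and the same sum of the vectors
`v ∈ {0,1}^e` that uses old labels only, and at most as many as there are colours plus a quadratic
polynomial in `e`. This is an analogue of the sparse integer Carathéodory theorem in which the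
number of colours enters with coefficient one. -/
theorem exists_sparse_relabelling {ι Y I : Type*} [DecidableEq ι] [DecidableEq Y] [DecidableEq I]
    {e : ℕ} (f : Y → I) (v : Y → Fin e → ℤ) (hv : ∀ y t, 0 ≤ v y t ∧ v y t ≤ 1)
    (U : Finset ι) (l : ι → Y) :
    ∃ l' : ι → Y, U.image l' ⊆ U.image l ∧ (∀ n, f (l' n) = f (l n)) ∧
      (∀ t, ∑ n ∈ U, v (l' n) t = ∑ n ∈ U, v (l n) t) ∧
      #(U.image l') ≤ #((U.image l).image f) + 2 * (e + 7) ^ 2 := by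
  induction h : #(U.image l) using Nat.strong_induction_on generalizing l with
  | _ c ih =>
    subst h
    by_cases hB : #((U.image l).image f) + 2 * (e + 7) ^ 2 < #(U.image l)
    · obtain ⟨l₁, hlt, hf₁, hs₁⟩ := exists_smaller_relabelling f v hv U l hB
      obtain ⟨l₂, hsub, hf₂, hs₂, hc⟩ := ih _ (card_lt_card hlt) l₁ rfl
      exact ⟨l₂, hsub.trans hlt.subset, fun n => (hf₂ n).trans (hf₁ n),
        fun t => (hs₂ t).trans (hs₁ t),
        hc.trans (Nat.add_le_add_right (card_le_card (image_subset_image hlt.subset)) _)⟩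
    · exact ⟨l, Subset.rfl, fun _ => rfl, fun _ => rfl, not_lt.1 hB⟩

/-! ### Bijections that preserve a colouring -/

/-- Two finite sets with equally many elements of each colour are in bijection by a map that
preserves the colours. -/
theorem exists_bijOn_of_card_fiber_eq {α β I : Type*} [Nonempty β] [DecidableEq I]
    (V : Finset α) (U : Finset β) (f : α → I) (g : β → I)
    (h : ∀ i, #{n ∈ V | f n = i} = #{u ∈ U | g u = i}) :
    ∃ e : α → β, Set.BijOn e V U ∧ ∀ n ∈ V, g (e n) = f n := by
  have hex : ∀ i, ∃ e : α → β,
      Set.BijOn e ({n ∈ V | f n = i} : Finset α) ({u ∈ U | g u = i} : Finset β) := fun i =>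
    (Finset.finite_toSet _).exists_bijOn_of_encard_eq (by
      rw [Set.encard_coe_eq_coe_finsetCard, Set.encard_coe_eq_coe_finsetCard, h i])
  simp only [coe_filter] at hex
  choose e he using hex
  have hmap : ∀ n ∈ V, e (f n) n ∈ U ∧ g (e (f n) n) = f n := fun n hn =>
    (he (f n)).mapsTo ⟨hn, rfl⟩
  refine ⟨fun n => e (f n) n, ⟨fun n hn => (hmap n hn).1, ?_, ?_⟩, fun n hn => (hmap n hn).2⟩
  · intro n hn n' hn' hnn
    have hf : f n = f n' := by
      rw [← (hmap n hn).2, ← (hmap n' hn').2]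
      exact congrArg g hnn
    refine (he (f n)).injOn ⟨hn, rfl⟩ ⟨hn', hf.symm⟩ ?_
    simpa [hf] using hnn
  · intro u hu
    obtain ⟨n, hn, hnu⟩ := (he (g u)).surjOn ⟨hu, rfl⟩
    refine ⟨n, hn.1, ?_⟩
    simpa [hn.2] using hnu

/-! ### Truth of a QFBAPA formula from cardinalities -/

/-- The bit-string of the set variables that contain `n`. -/
def bits {ι : Type*} [DecidableEq ι] {k : ℕ} (S : Fin k → Finset ι) (n : ι) : Fin k → Bool :=
  fun i => decide (n ∈ S i)

/-- Truth value of a Boolean term at a bit-string, which says whether the elements with that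
bit-string belong to the set that the term denotes. -/
def BTerm.Holds {k : ℕ} : BTerm k → (Fin k → Bool) → Bool
  | .var i, β => β i
  | .empty, _ => false
  | .univ, _ => true
  | .union a b, β => a.Holds β || b.Holds β
  | .inter a b, β => a.Holds β && b.Holds β
  | .compl a, β => !a.Holds β

/-- The Boolean terms under a cardinality sign. -/
def ITerm.cardTerms {k : ℕ} : ITerm k → List (BTerm k)
  | .var _ => []
  | .const _ => []
  | .add a b => a.cardTerms ++ b.cardTerms
  | .smul _ a => a.cardTerms
  | .card b => [b]

/-- Boolean terms whose cardinalities determine the truth of the formula: those under a cardinality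
sign, the difference `a \ b` for an atom `a ⊆ b`, and the symmetric difference for an atom `a = b`.
-/
def QFBAPA.cardTerms {k : ℕ} : QFBAPA k → List (BTerm k)
  | .setEq a b => [.union (.inter a (.compl b)) (.inter b (.compl a))]
  | .setSub a b => [.inter a (.compl b)]
  | .eq a b => a.cardTerms ++ b.cardTerms
  | .le a b => a.cardTerms ++ b.cardTerms
  | .dvd _ a => a.cardTerms
  | .and a b => a.cardTerms ++ b.cardTerms
  | .or a b => a.cardTerms ++ b.cardTerms
  | .not a => a.cardTerms

theorem ITerm.length_cardTerms_le {k : ℕ} (a : ITerm k) : a.cardTerms.length ≤ a.size := by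
  induction a <;> simp only [cardTerms, size, List.length_append, List.length_nil,
    List.length_singleton] <;> omega

theorem QFBAPA.length_cardTerms_le {k : ℕ} (F : QFBAPA k) : F.cardTerms.length ≤ F.size := by
  induction F with
  | eq a b | le a b =>
    have := a.length_cardTerms_le
    have := b.length_cardTerms_le
    simp only [cardTerms, size, List.length_append]
    omega
  | dvd c a =>
    have := a.length_cardTerms_le
    simp only [cardTerms, size]
    omega
  | _ => simp only [cardTerms, size, List.length_append, List.length_singleton]; omega

theorem BTerm.mem_eval {ι : Type*} [DecidableEq ι] {k : ℕ} {U : Finset ι} {S : Fin k → Finset ι}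
    (hS : ∀ i, S i ⊆ U) (a : BTerm k) (n : ι) :
    n ∈ a.eval U S ↔ n ∈ U ∧ a.Holds (bits S n) = true := by
  induction a with
  | var i => simpa [eval, Holds, bits] using fun h => hS i h
  | empty => simp [eval, Holds]
  | univ => simp [eval, Holds]
  | union a b iha ihb => simp [eval, Holds, iha, ihb, and_or_left]
  | inter a b iha ihb => simp only [eval, Holds, mem_inter, iha, ihb, Bool.and_eq_true]; tauto
  | compl a iha => simp +contextual [eval, Holds, iha]

theorem BTerm.eval_eq_filter {ι : Type*} [DecidableEq ι] {k : ℕ} {U : Finset ι}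
    {S : Fin k → Finset ι} (hS : ∀ i, S i ⊆ U) (a : BTerm k) :
    a.eval U S = {n ∈ U | a.Holds (bits S n) = true} := by
  ext n
  rw [a.mem_eval hS, mem_filter]

theorem BTerm.eval_subset {ι : Type*} [DecidableEq ι] {k : ℕ} {U : Finset ι}
    {S : Fin k → Finset ι} (hS : ∀ i, S i ⊆ U) (a : BTerm k) : a.eval U S ⊆ U :=
  fun n hn => ((a.mem_eval hS n).1 hn).1

theorem BTerm.card_eval {ι : Type*} [DecidableEq ι] {k : ℕ} {U : Finset ι}
    {S : Fin k → Finset ι} (hS : ∀ i, S i ⊆ U) (a : BTerm k) :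
    (#(a.eval U S) : ℤ) = ∑ n ∈ U, if a.Holds (bits S n) then 1 else 0 := by
  rw [a.eval_eq_filter hS, card_filter]
  push_cast
  rfl

theorem BTerm.eval_subset_eval_iff {ι : Type*} [DecidableEq ι] {k : ℕ} {U : Finset ι}
    {S : Fin k → Finset ι} (hS : ∀ i, S i ⊆ U) (a b : BTerm k) :
    a.eval U S ⊆ b.eval U S ↔ #((BTerm.inter a (.compl b)).eval U S) = 0 := by
  have ha := a.eval_subset hS
  rw [card_eq_zero, eq_empty_iff_forall_notMem]
  simp only [eval, mem_inter, mem_sdiff]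
  exact ⟨fun h n hn => hn.2.2 (h hn.1), fun h n hn => by
    by_contra hb
    exact h n ⟨hn, ha hn, hb⟩⟩

theorem BTerm.eval_eq_eval_iff {ι : Type*} [DecidableEq ι] {k : ℕ} {U : Finset ι}
    {S : Fin k → Finset ι} (hS : ∀ i, S i ⊆ U) (a b : BTerm k) :
    a.eval U S = b.eval U S ↔
      #((BTerm.union (.inter a (.compl b)) (.inter b (.compl a))).eval U S) = 0 := by
  rw [Subset.antisymm_iff, eval_subset_eval_iff hS, eval_subset_eval_iff hS]
  simp [eval, union_eq_empty]

section Congr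

variable {ι ι' : Type*} [DecidableEq ι] [DecidableEq ι'] {k : ℕ} {U : Finset ι} {U' : Finset ι'}
  {S : Fin k → Finset ι} {S' : Fin k → Finset ι'}

theorem ITerm.eval_congr (v : ℕ → ℤ) (a : ITerm k)
    (h : ∀ t ∈ a.cardTerms, #(t.eval U S) = #(t.eval U' S')) :
    a.eval U S v = a.eval U' S' v := by
  induction a with
  | var i => rfl
  | const c => rfl
  | add a b iha ihb =>
    simp only [eval, iha fun t ht => h t (List.mem_append_left _ ht),
      ihb fun t ht => h t (List.mem_append_right _ ht)]
  | smul c a iha => simp only [eval, iha h]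
  | card b => simp only [eval, h b (by simp [cardTerms])]

theorem QFBAPA.sat_congr (hS : ∀ i, S i ⊆ U) (hS' : ∀ i, S' i ⊆ U') (v : ℕ → ℤ) (F : QFBAPA k)
    (h : ∀ t ∈ F.cardTerms, #(t.eval U S) = #(t.eval U' S')) :
    F.Sat U S v ↔ F.Sat U' S' v := by
  induction F with
  | setEq a b =>
    simp only [Sat, BTerm.eval_eq_eval_iff hS, BTerm.eval_eq_eval_iff hS',
      h _ (List.mem_singleton_self _)]
  | setSub a b =>
    simp only [Sat, BTerm.eval_subset_eval_iff hS, BTerm.eval_subset_eval_iff hS',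
      h _ (List.mem_singleton_self _)]
  | eq a b | le a b =>
    simp only [Sat, a.eval_congr v fun t ht => h t (List.mem_append_left _ ht),
      b.eval_congr v fun t ht => h t (List.mem_append_right _ ht)]
  | dvd c a => simp only [Sat, a.eval_congr v h]
  | and a b iha ihb | or a b iha ihb =>
    simp only [Sat, iha fun t ht => h t (List.mem_append_left _ ht),
      ihb fun t ht => h t (List.mem_append_right _ ht)]
  | not a iha => simp only [Sat, iha h]

/-- A formula does not distinguish universes in which each of its terms has the same cardinality.
The cardinalities are written as sums over the universe of the truth values at the bit-strings. -/
theorem QFBAPA.Holds.congr (hS : ∀ i, S i ⊆ U) (hS' : ∀ i, S' i ⊆ U') {F : QFBAPA k}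
    (h : ∀ t ∈ F.cardTerms, (∑ n ∈ U, if t.Holds (bits S n) then (1 : ℤ) else 0) =
      ∑ n ∈ U', if t.Holds (bits S' n) then 1 else 0)
    (hF : F.Holds U S) : F.Holds U' S' := by
  obtain ⟨v, hv⟩ := hF
  refine ⟨v, (F.sat_congr hS hS' v fun t ht => ?_).1 hv⟩
  have := h t ht
  rw [← t.card_eval hS, ← t.card_eval hS'] at this
  exact_mod_cast this

end Congr

theorem mem_venn_iff {ι : Type*} [DecidableEq ι] {k : ℕ} {U : Finset ι} {S : Fin k → Finset ι}
    {β : Fin k → Bool} {n : ι} : n ∈ venn U S β ↔ n ∈ U ∧ bits S n = β := by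
  simp only [venn, mem_filter, and_congr_right_iff, funext_iff, bits]
  intro hn
  refine forall_congr' fun i => ?_
  cases β i <;> simp [hn]

theorem mem_region_iff {ι : Type*} [DecidableEq ι] {k : ℕ} {U : Finset ι} {S : Fin k → Finset ι}
    {L : PropForm k} {n : ι} : n ∈ region U S L ↔ n ∈ U ∧ L.Models (bits S n) := by
  simp only [region, mem_filter, mem_venn_iff, and_congr_right_iff]
  intro hn
  exact ⟨fun ⟨β, h, _, hβ⟩ => hβ ▸ h, fun h => ⟨_, h, hn, rfl⟩⟩

theorem charFormula_iff {D Ψ : Type*} {A : BooleanAlg D Ψ} {k : ℕ} {φ : Fin k → Ψ}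
    {β : Fin k → Bool} {d : D} :
    A.CharFormula φ β d ↔ ∀ i, β i = true ↔ d ∈ A.den (φ i) := by
  refine forall_congr' fun i => ?_
  cases β i <;> simp [A.den_neg]

/-! ### Trees, runs and symbolic tables -/

/-- The tree with the domain of `t` and the label `h n` at each position `n` of it. -/
def relabelTree {α β : Type*} : BinaryTree α → (List Bool → β) → BinaryTree β
  | .nil, _ => .nil
  | .node _ l r, h =>
    .node (h []) (relabelTree l fun n => h (false :: n)) (relabelTree r fun n => h (true :: n))

theorem labelAt_relabelTree {α β : Type*} (t : BinaryTree α) (h : List Bool → β) (n : List Bool) :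
    labelAt (relabelTree t h) n = (labelAt t n).map fun _ => h n := by
  induction t generalizing h n with
  | nil => rfl
  | node a l r ihl ihr =>
    match n with
    | [] => rfl
    | false :: n => exact ihl _ n
    | true :: n => exact ihr _ n

theorem positions_relabelTree {α β : Type*} (t : BinaryTree α) (h : List Bool → β) :
    positions (relabelTree t h) = positions t := by
  ext n
  simp [positions, labelAt_relabelTree]

theorem positions_finite {α : Type*} (t : BinaryTree α) : (positions t).Finite := by
  induction t with
  | nil => exact Set.Finite.subset Set.finite_empty fun n hn => by simp [positions, labelAt] at hn
  | node a l r ihl ihr =>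
    refine (((ihl.image (List.cons false)).union (ihr.image (List.cons true))).insert []).subset ?_
    intro n hn
    match n with
    | [] => exact Or.inl rfl
    | false :: n => exact Or.inr (Or.inl ⟨n, hn, rfl⟩)
    | true :: n => exact Or.inr (Or.inr ⟨n, hn, rfl⟩)

/-- The accepted trees are the instances of the symbolic ones: reading off the guards of a run gives
a symbolic tree with the same domain. -/
theorem STA.accepts_iff_exists_symbolic {Q Ψ α : Type*} {M : STA Q Ψ} {sat : Ψ → α → Prop}
    {q : Q} {t : BinaryTree α} :
    M.Accepts sat q t ↔ ∃ s, M.Accepts (fun x y => x = y) q s ∧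
      ∀ n, Option.Rel sat (labelAt s n) (labelAt t n) := by
  constructor
  · intro h
    induction h with
    | nil h => exact ⟨.nil, .nil h, fun n => .none⟩
    | node ht hs _ _ ihl ihr =>
      obtain ⟨sl, hsl, hl⟩ := ihl
      obtain ⟨sr, hsr, hr⟩ := ihr
      refine ⟨.node _ sl sr, .node ht rfl hsl hsr, fun n => ?_⟩
      match n with
      | [] => exact .some hs
      | false :: n => exact hl n
      | true :: n => exact hr n
  · rintro ⟨s, hs, h⟩
    induction hs generalizing t with
    | nil hq =>
      cases t with
      | nil => exact .nil hq
      | node a l r => nomatch h []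
    | node ht hs _ _ ihl ihr =>
      subst hs
      cases t with
      | nil => nomatch h []
      | node a l r =>
        refine .node ht ?_ (ihl fun n => h (false :: n)) (ihr fun n => h (true :: n))
        cases h [] with
        | some h => exact h

theorem STA.Accepts.label_mem_guards {Q Ψ : Type*} {M : STA Q Ψ} {q : Q} {s : BinaryTree Ψ}
    (hs : M.Accepts (fun x y => x = y) q s) {n : List Bool} {x : Ψ} (hx : labelAt s n = some x) :
    x ∈ M.guards := by
  induction hs generalizing n with
  | nil => simp [labelAt] at hx
  | node ht h _ _ ihl ihr =>
    match n with
    | [] =>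
      obtain rfl := Option.some.inj hx
      exact ⟨_, _, _, h ▸ ht⟩
    | false :: n => exact ihl hx
    | true :: n => exact ihr hx

theorem STA.guards_relabel_subset {Q Ψ X : Type*} (M : STA Q Ψ) {m : ℕ} (ψ : Fin m → Ψ)
    (L : Fin m → X) : (M.relabel ψ L).guards ⊆ Set.range L := by
  rintro x ⟨_, _, _, j, hj, _⟩
  exact ⟨j, hj.symm⟩

/-! ### Transfer between tables and the cardinality formula -/

/-- The domain, the run and the letters at the positions are kept. The bit-strings at the positions
are replaced by few of them, each taken from a position with the same letter, so that it still
models the letter and its character formula is still satisfiable. -/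
theorem TablePowerCard.elimPropCard {D Ψ Q : Type*} {k m : ℕ} {A : BooleanAlg D Ψ} {φ : Fin k → Ψ}
    {M : STA Q (PropForm k)} {L : Fin m → PropForm k} {F : QFBAPA k} {b : ℕ}
    (hm : 0 < m) (hL : Function.Injective L) (hM : M.guards ⊆ Set.range L)
    (hb : 2 * (F.size + 7) ^ 2 ≤ b) (h : TablePowerCard A φ M F) : ElimPropCard A φ M L F b := by
  obtain ⟨U, S, hF, ⟨d, hdU, hdS⟩, τ, hτ, hτU, hτS⟩ := h
  have hSU : ∀ i, S i ⊆ U := fun i n hn => by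
    obtain ⟨a, ha, _⟩ := (hdS i n).1 hn
    rw [← mem_coe, ← hdU]
    simp [positions, ha]
  obtain ⟨s, hs, hrel⟩ := STA.accepts_iff_exists_symbolic.1 hτ
  have hlabel : ∀ n ∈ U, ∃ j, labelAt s n = some (L j) ∧ (L j).Models (bits S n) := by
    intro n hn
    rw [← mem_coe, ← hτU, positions, Set.mem_ofPred_eq, Option.isSome_iff_exists] at hn
    obtain ⟨β, hβ⟩ := hn
    have h1 := hrel n
    rw [hβ] at h1
    generalize hx : labelAt s n = x at h1
    cases h1 with
    | some h1 =>
      obtain ⟨j, rfl⟩ := hM (hs.label_mem_guards hx)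
      refine ⟨j, rfl, ?_⟩
      convert h1
      funext i
      simp [bits, hτS, hβ]
  have hlabelU : ∀ n x, labelAt s n = some x → n ∈ U := by
    intro n x hx
    have h1 := hrel n
    rw [hx] at h1
    generalize hy : labelAt τ n = y at h1
    cases h1 with
    | some _ => rw [← mem_coe, ← hτU]; simp [positions, hy]
  have : Nonempty (Fin m) := ⟨⟨0, hm⟩⟩
  choose! j hj hjS using hlabel
  -- The label of a position is its letter, which is also its colour, together with its bit-string.
  obtain ⟨l, hlsub, hlfst, hlsum, hlcard⟩ := exists_sparse_relabelling (e := F.cardTerms.length)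
    (f := (Prod.fst : Fin m × (Fin k → Bool) → Fin m))
    (fun y t => if (F.cardTerms.get t).Holds y.2 then 1 else 0)
    (fun y t => by split_ifs <;> simp) U (fun n => (j n, bits S n))
  have hl : ∀ n ∈ U, ∃ n₀ ∈ U, j n₀ = j n ∧ bits S n₀ = (l n).2 := by
    intro n hn
    obtain ⟨n₀, hn₀, h⟩ := mem_image.1 (hlsub (mem_image_of_mem l hn))
    exact ⟨n₀, hn₀, (congrArg Prod.fst h).trans (hlfst n), congrArg Prod.snd h⟩
  set S' : Fin k → Finset (List Bool) := fun i => {n ∈ U | (l n).2 i = true} with hS'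
  have hS'U : ∀ i, S' i ⊆ U := fun i => filter_subset _ _
  have hbits : ∀ n ∈ U, bits S' n = (l n).2 := fun n hn => by
    funext i
    simp [bits, hS', hn]
  set B := U.image fun n => (l n).2 with hB
  -- The letters that occur are listed by `σ`. The empty tree has none, but `s = 0` is not allowed,
  -- so that one unused letter is listed for it.
  obtain ⟨J, hJne, hjJ, hJcard⟩ : ∃ J : Finset (Fin m), J.Nonempty ∧ (∀ n ∈ U, j n ∈ J) ∧
      #((U.image fun n => (j n, bits S n)).image Prod.fst) ≤ #J := by
    rcases U.eq_empty_or_nonempty with rfl | hU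
    · exact ⟨{⟨0, hm⟩}, singleton_nonempty _, by simp, by simp⟩
    · exact ⟨U.image j, hU.image j, fun n hn => mem_image_of_mem j hn,
        by rw [image_image]; exact le_rfl⟩
  set σ : Fin #J ↪ Fin m := (J.orderEmbOfFin rfl).toEmbedding with hσ
  have hσJ : ∀ i, i ∈ J → i ∈ Set.range σ := fun i hi => by
    simpa [hσ] using hi
  have hcover : (univ.biUnion fun i => {n ∈ U | j n = σ i}) = U := by
    ext n
    simp only [mem_biUnion, mem_univ, true_and, mem_filter]
    refine ⟨fun ⟨_, h, _⟩ => h, fun hn => ?_⟩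
    obtain ⟨i, hi⟩ := hσJ _ (hjJ n hn)
    exact ⟨i, hn, hi.symm⟩
  have hocc : ∀ i, #{n ∈ U | j n = i} = occurrences s (L i) := by
    intro i
    rw [← Set.ncard_coe_finset]
    unfold occurrences
    congr 1
    ext n
    simp only [coe_filter, Set.mem_ofPred_eq]
    constructor
    · rintro ⟨hn, rfl⟩
      exact hj n hn
    · intro h
      have hn := hlabelU n _ h
      exact ⟨hn, hL (Option.some.inj ((hj n hn).symm.trans h))⟩
  refine ⟨#J, ⟨hJne.card_pos, by simpa using card_le_univ J⟩, #B, ?_, σ,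
    fun i => B.equivFin.symm i, ?_, fun i => occurrences s (L i), U, S',
    fun i => {n ∈ U | j n = σ i}, hS'U, ⟨s, hs, fun _ => rfl⟩, ?_, ?_, ?_, hcover.symm, ?_,
    fun i => hocc _, ?_, ?_⟩
  · have h1 : #B ≤ #(U.image l) := by
      have : B = (U.image l).image Prod.snd := by rw [image_image]; rfl
      rw [this]
      exact card_image_le
    have h3 : (F.cardTerms.length + 7) ^ 2 ≤ (F.size + 7) ^ 2 :=
      Nat.pow_le_pow_left (Nat.add_le_add_right F.length_cardTerms_le 7) 2
    omega
  · intro i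
    obtain ⟨n, hn, hni⟩ := mem_image.1 (B.equivFin.symm i).2
    obtain ⟨n₀, hn₀, -, h⟩ := hl n hn
    have hn₀d := hn₀
    rw [← mem_coe, ← hdU, positions, Set.mem_ofPred_eq, Option.isSome_iff_exists] at hn₀d
    obtain ⟨a, ha⟩ := hn₀d
    refine ⟨a, charFormula_iff.2 fun i' => ?_⟩
    dsimp only
    rw [← hni, ← h]
    simp [bits, hdS, ha]
  · intro i hi
    dsimp only
    rw [← hocc, card_eq_zero, filter_eq_empty_iff]
    rintro n hn rfl
    exact hi (hσJ _ (hjJ n hn))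
  · intro i n hn
    obtain ⟨hn, hni⟩ := mem_filter.1 hn
    obtain ⟨n₀, hn₀, hjn, h⟩ := hl n hn
    rw [mem_region_iff, hbits n hn, ← h, ← hni]
    exact ⟨hn, hjn ▸ hjS n₀ hn₀⟩
  · intro i i' hne
    rw [disjoint_left]
    intro n hn hn'
    exact hne (σ.injective ((mem_filter.1 hn).2.symm.trans (mem_filter.1 hn').2))
  · rw [hcover]
    ext n
    simp only [mem_biUnion, mem_univ, true_and, mem_region_iff]
    refine ⟨fun ⟨_, h, _⟩ => h, fun hn => ⟨j n, hn, ?_⟩⟩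
    obtain ⟨n₀, hn₀, hjn, h⟩ := hl n hn
    rw [hbits n hn, ← h]
    exact hjn ▸ hjS n₀ hn₀
  · rw [hcover]
    ext n
    simp only [mem_biUnion, mem_univ, true_and, mem_venn_iff]
    refine ⟨fun ⟨_, h, _⟩ => h, fun hn => ⟨B.equivFin ⟨_, mem_image_of_mem _ hn⟩, hn, ?_⟩⟩
    simp [hbits n hn]
  · refine QFBAPA.Holds.congr hSU hS'U (fun t ht => ?_) hF
    obtain ⟨i, rfl⟩ := List.get_of_mem ht
    rw [sum_congr (g := fun n => if (F.cardTerms.get i).Holds (l n).2 then (1 : ℤ) else 0)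
      (s₁ := U) (s₂ := U) (f := fun n => if (F.cardTerms.get i).Holds (bits S' n) then 1 else 0)
      rfl fun n hn => by rw [hbits n hn]]
    exact (hlsum i).symm

/-- The set `U` need not be the domain of a tree, but it has as many elements as the symbolic table
with Parikh image `c` has positions. The sets are pulled back along a bijection from these positions
to `U` that sends the positions with letter `L (σ i)` to `P i`. -/
theorem ElimPropCard.tablePowerCard {D Ψ Q : Type*} {k m : ℕ} {A : BooleanAlg D Ψ} {φ : Fin k → Ψ}
    {M : STA Q (PropForm k)} {L : Fin m → PropForm k} {F : QFBAPA k} {b : ℕ}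
    (hL : Function.Injective L) (hM : M.guards ⊆ Set.range L)
    (h : ElimPropCard A φ M L F b) : TablePowerCard A φ M F := by
  obtain ⟨r, ⟨hr, -⟩, N, -, σ, β, hβ, c, U, S, P, hSU, ⟨s, hs, hc⟩, hσ, hPL, hPd, hUP, -, hPc, hUβ,
    hF⟩ := h
  rw [← hUP] at hUβ
  have : Nonempty (Fin r) := ⟨⟨0, hr⟩⟩
  set V := (positions_finite s).toFinset with hV
  have hVmem : ∀ n, n ∈ V ↔ ∃ x, labelAt s n = some x := fun n => by
    simp [hV, positions, Option.isSome_iff_exists]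
  -- A letter that occurs has a positive count, so it is one of the letters chosen by `σ`.
  have hidx : ∀ n ∈ V, ∃ i, labelAt s n = some (L (σ i)) := by
    intro n hn
    obtain ⟨x, hx⟩ := (hVmem n).1 hn
    obtain ⟨j, rfl⟩ := hM (hs.label_mem_guards hx)
    by_contra! hne
    have h0 := hσ j (by rintro ⟨i, rfl⟩; exact hne i hx)
    rw [hc, occurrences, Set.ncard_eq_zero
      ((positions_finite s).subset fun n' hn' => by
        rw [Set.mem_ofPred_eq] at hn'; simp [positions, hn'])] at h0
    exact (h0 ▸ hx : n ∈ (∅ : Set (List Bool)))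
  choose! f hf using hidx
  have hPidx : ∀ n ∈ U, ∃ i, n ∈ P i := fun n hn => by
    rw [hUP] at hn
    simpa using hn
  choose! g hg using hPidx
  have hgP : ∀ i, {u ∈ U | g u = i} = P i := by
    intro i
    ext u
    rw [mem_filter]
    constructor
    · rintro ⟨hu, rfl⟩
      exact hg u hu
    · intro hu
      have huU : u ∈ U := by
        rw [hUP]
        exact mem_biUnion.2 ⟨i, mem_univ _, hu⟩
      refine ⟨huU, ?_⟩
      by_contra hne
      exact disjoint_left.1 (hPd _ _ hne) (hg u huU) hu
  obtain ⟨e, he, heg⟩ := exists_bijOn_of_card_fiber_eq V U f g (by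
    intro i
    rw [hgP, hPc, hc, occurrences, ← Set.ncard_coe_finset]
    congr 1
    ext n
    simp only [coe_filter, Set.mem_ofPred_eq]
    constructor
    · rintro ⟨hn, rfl⟩
      exact hf n hn
    · intro h
      have hn := (hVmem n).2 ⟨_, h⟩
      exact ⟨hn, σ.injective (hL (Option.some.inj ((hf n hn).symm.trans h)))⟩)
  have heU : ∀ n ∈ V, e n ∈ U := fun n hn => he.mapsTo hn
  have hd : ∀ n ∈ V, ∃ d, A.CharFormula φ (bits S (e n)) d := by
    intro n hn
    have hn' := heU n hn
    rw [← hUβ] at hn'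
    simp only [mem_biUnion, mem_univ, true_and, mem_venn_iff] at hn'
    obtain ⟨i, -, hi⟩ := hn'
    rw [hi]
    exact hβ i
  set S' : Fin k → Finset (List Bool) := fun i => {n ∈ V | e n ∈ S i} with hS'
  have hbits : ∀ n ∈ V, bits S' n = bits S (e n) := fun n hn => by
    funext i
    simp [bits, hS', hn]
  refine ⟨V, S', ?_, ?_, relabelTree s fun n => bits S' n, ?_, ?_, ?_⟩
  · refine QFBAPA.Holds.congr hSU (fun i => filter_subset _ _) (fun t _ => ?_) hF
    refine (sum_bij (fun n _ => e n) heU he.injOn (fun u hu => ?_) fun n hn => ?_).symm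
    · obtain ⟨n, hn, h⟩ := he.surjOn hu
      exact ⟨n, hn, h⟩
    · rw [hbits n hn]
  · -- `D` may be empty, but only if there are no positions; then the tree is `nil`.
    rcases V.eq_empty_or_nonempty with hVe | ⟨n₀, hn₀⟩
    · refine ⟨.nil, ?_, fun i n => ?_⟩
      · rw [hVe]; ext n; simp [positions, labelAt]
      · simp [hS', hVe, labelAt]
    have : Nonempty D := ⟨(hd n₀ hn₀).choose⟩
    choose! d hd using hd
    refine ⟨relabelTree s d, by rw [positions_relabelTree]; simp [hV], fun i n => ?_⟩
    rw [labelAt_relabelTree]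
    by_cases hn : n ∈ V
    · obtain ⟨x, hx⟩ := (hVmem n).1 hn
      have h1 := charFormula_iff.1 (hd n hn) i
      simp [hS', hn, hx, ← h1, bits]
    · have hx : labelAt s n = none := by
        rw [hVmem] at hn
        simpa [Option.eq_none_iff_forall_ne_some] using hn
      simp [hS', hn, hx]
  · refine STA.accepts_iff_exists_symbolic.2 ⟨s, hs, fun n => ?_⟩
    rw [labelAt_relabelTree]
    by_cases hn : n ∈ V
    · rw [hf n hn]
      refine .some ?_
      rw [hbits n hn, ← heg n hn]
      exact (mem_region_iff.1 (hPL _ (hg _ (heU n hn)))).2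
    · have hx : labelAt s n = none := by
        rw [hVmem] at hn
        simpa [Option.eq_none_iff_forall_ne_some] using hn
      rw [hx]
      exact .none
  · rw [positions_relabelTree]
    simp [hV]
  · intro i n
    rw [labelAt_relabelTree]
    by_cases hn : n ∈ V
    · obtain ⟨x, hx⟩ := (hVmem n).1 hn
      simp [hx, bits]
    · have hx : labelAt s n = none := by
        rw [hVmem] at hn
        simpa [Option.eq_none_iff_forall_ne_some] using hn
      simp [hS', hn, hx]

end SymbolicTree

theorem theorem2 :
    ∃ p : Polynomial ℕ,
      ∀ {D Ψ Q : Type*} [Finite Q] {k m : ℕ} (_ : 0 < m)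
        (A : SymbolicTree.BooleanAlg D Ψ) (M : SymbolicTree.STA Q Ψ)
        (φ : Fin k → Ψ) (ψ : Fin m → Ψ) (_ : Set.range ψ = M.guards)
        (L : Fin m → SymbolicTree.PropForm k) (_ : Function.Injective L)
        (_ : ∀ j, A.den (ψ j) = A.den (A.interp φ (L j)))
        (F : SymbolicTree.QFBAPA k),
        SymbolicTree.TablePowerCard A φ (M.relabel ψ L) F ↔
          SymbolicTree.ElimPropCard A φ (M.relabel ψ L) L F (p.eval F.size) := by
  refine ⟨2 * (Polynomial.X + 7) ^ 2, ?_⟩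
  intro D Ψ Q _ k m hm A M φ ψ _ L hL _ F
  have hM := M.guards_relabel_subset ψ L
  exact ⟨fun h => h.elimPropCard hm hL hM (by simp), fun h => h.tablePowerCard hL hM⟩
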